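/- Let $G$ be a locally compact second countable (Hausdorff) group and let $\mu$ be an admissible probability measure on $G$: some convolution power $\mu^{*k}$, $k\ge 1$, is absolutely continuous with respect to Haar measure, and the smallest closed subgroup of $G$ containing $\operatorname{supp}\mu$ is $G$. A flow $(X,G)$ is a nonempty compact Hausdorff space $X$ with a (jointly) continuous action of $G$; measures on $X$ are regular Borel. It is minimal if every orbit is dense, and strongly proximal if for every Borel probability measure $\rho$ on $X$ there are a net $g_i\in G$ and a point $x\in X$ with $(g_i)_*\rho\to\delta_x$ in the weak-* topology. A flow $Y$ is a factor of a flow $X$ if there is a continuous $G$-equivariant surjection $X\to Y$. The universal minimal strongly proximal flow $\Pi_s(G)$ is the minimal strongly proximal flow of which every minimal strongly proximal flow is a factor. Let $\mathcal H$ be the space, with the sup norm, of bounded functions $f:G\to\mathbb C$ that are left uniformly continuous ($\sup_{g}|f(hg)-f(g)|\to 0$ as $h\to e$) and $\mu$-harmonic ($f(g)=\int f(gh)\,d\mu(h)$ for all $g\in G$). The topological universal Poisson $\mu$-boundary $(B,\nu)$ is the flow $(B,G)$ with a $\mu$-stationary probability measure $\nu$ (that is, $\mu*\nu=\nu$) for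 which $$L_\nu F(g)=\int_B F(gx)\,d\nu(x)$$ defines an isometric linear isomorphism of $C(B)$ onto $\mathcal H$. Then for every minimal subset $M$ of $B$ (a nonempty closed $G$-invariant subset in which every orbit is dense), the flow $\Pi_s(G)$ is a factor of $M$. -/

import Mathlib

open MeasureTheory Filter Topology
open scoped BoundedContinuousFunction

universe u v w

namespace PoissonFlow

/-! A *flow* `(X, G)` is a nonempty compact Hausdorff space `X` with a jointly continuous action
of `G` (`CompactSpace X`, `T2Space X`, `Nonempty X`, `MulAction G X`, `ContinuousSMul G X`).
For compact `X`, joint continuity is the same as continuity of `G → Homeo(X)` for the topology of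
uniform convergence.  Minimality (every orbit is dense) is `MulAction.IsMinimal G X`. -/

/-- `Y` is a factor of `X`: there is an equivariant continuous surjection `X → Y`. -/
def IsFactor (G : Type u) [Group G] (X : Type v) [TopologicalSpace X] [MulAction G X]
    (Y : Type w) [TopologicalSpace Y] [MulAction G Y] : Prop :=
  ∃ φ : X → Y, Continuous φ ∧ Function.Surjective φ ∧ ∀ (g : G) (x : X), φ (g • x) = g • φ x

/-- The translate `g_* ν` of a Borel probability measure `ν` on a `G`-space. -/
noncomputable def translate {G : Type u} [Group G] {X : Type v} [TopologicalSpace X]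
    [MulAction G X] [ContinuousConstSMul G X] [MeasurableSpace X] [BorelSpace X]
    (g : G) (ν : ProbabilityMeasure X) : ProbabilityMeasure X :=
  ν.map (f := fun x => g • x) (continuous_const_smul g).measurable.aemeasurable

/-- Strong proximality: for every regular Borel probability measure `ν` there are a net in `G`
(here: a proper filter on `G`) and a point `x` such that the translates of `ν` along the net
converge to the point mass at `x` in the weak-* topology (the topology of
`ProbabilityMeasure X`). -/
def IsStronglyProximal (G : Type u) [Group G] (X : Type v) [TopologicalSpace X]
    [MulAction G X] [ContinuousConstSMul G X] [MeasurableSpace X] [BorelSpace X] : Prop :=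
  ∀ ν : ProbabilityMeasure X, (ν : Measure X).Regular →
    ∃ (l : Filter G) (x : X), l.NeBot ∧ Tendsto (fun g => translate g ν) l (𝓝 (diracProba x))

/-- The flow `(P, G)` is a universal minimal strongly proximal flow: it is a minimal strongly
proximal flow, and every minimal strongly proximal flow is a factor of it.  (A minimal flow
contains a dense image of `G`, so its cardinality is at most `2 ^ 2 ^ |G|`, and up to isomorphism
it lives in the universe of `G`.) -/
structure IsUniversalMinimalStronglyProximal (G : Type u) [Group G] [TopologicalSpace G]
    (P : Type u) [TopologicalSpace P] [CompactSpace P] [T2Space P] [MulAction G P]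
    [ContinuousSMul G P] [MeasurableSpace P] [BorelSpace P] : Prop where
  nonempty : Nonempty P
  minimal : MulAction.IsMinimal G P
  stronglyProximal : IsStronglyProximal G P
  universal : ∀ (Y : Type u) [TopologicalSpace Y] [CompactSpace Y] [T2Space Y] [Nonempty Y]
    [MulAction G Y] [ContinuousSMul G Y] [MeasurableSpace Y] [BorelSpace Y],
    MulAction.IsMinimal G Y → IsStronglyProximal G Y → IsFactor G P Y

/-- The convolution powers `μ^{*n}` (with `μ^{*0} = δ_1`). -/
noncomputable def convPow {G : Type u} [Group G] [MeasurableSpace G] (μ : Measure G) :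
    ℕ → Measure G
  | 0 => Measure.dirac 1
  | n + 1 => (convPow μ n).mconv μ

/-- Admissibility of a probability measure `μ` on a locally compact group: some convolution power
`μ^{*k}`, `k ≥ 1`, is absolutely continuous with respect to Haar measure, and the smallest closed
subgroup containing the support of `μ` is the whole group. -/
structure IsAdmissible {G : Type u} [Group G] [TopologicalSpace G] [IsTopologicalGroup G]
    [LocallyCompactSpace G] [MeasurableSpace G] [BorelSpace G] (μ : Measure G)
    [IsProbabilityMeasure μ] : Prop where
  absolutelyContinuous : ∃ k : ℕ, 1 ≤ k ∧ (convPow μ k).AbsolutelyContinuous Measure.haar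
  generates : (Subgroup.closure μ.support).topologicalClosure = ⊤

/-- `ν` is `μ`-stationary, `μ * ν = ν`, as functionals on `C(X)`. -/
def IsStationary {G : Type u} [Group G] [MeasurableSpace G] (μ : Measure G)
    {X : Type v} [TopologicalSpace X] [MulAction G X] [MeasurableSpace X]
    (ν : Measure X) : Prop :=
  ∀ F : C(X, ℝ), ∫ g, ∫ x, F (g • x) ∂ν ∂μ = ∫ x, F x ∂ν

/-- Left uniform continuity: `sup_g |f (h g) - f g| → 0` as `h → 1`.  This is the uniform
continuity of the functions `g ↦ ∫ F (g x) dν(x)`, `F` continuous on a flow. -/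
def IsLeftUniformlyContinuous {G : Type u} [Group G] [TopologicalSpace G] (f : G → ℂ) : Prop :=
  ∀ ε : ℝ, 0 < ε → ∀ᶠ h in 𝓝 (1 : G), ∀ g : G, ‖f (h * g) - f g‖ < ε

/-- The space of bounded left uniformly continuous `μ`-harmonic functions
(`f g = ∫ f (g h) dμ(h)` for all `g`), with the sup norm. -/
def harmonicSpace {G : Type u} [Group G] [TopologicalSpace G] [IsTopologicalGroup G]
    [SecondCountableTopology G] [MeasurableSpace G] [BorelSpace G]
    (μ : Measure G) [IsFiniteMeasure μ] : Submodule ℂ (G →ᵇ ℂ) where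
  carrier := {f | IsLeftUniformlyContinuous (f : G → ℂ) ∧ ∀ g : G, ∫ h, f (g * h) ∂μ = f g}
  zero_mem' := ⟨fun ε hε => by simp [hε], fun g => by simp⟩
  add_mem' := by
    have hint : ∀ (f : G →ᵇ ℂ) (g : G), Integrable (fun h => f (g * h)) μ := fun f g =>
      (f.compContinuous ⟨fun h => g * h, continuous_const_mul g⟩).integrable μ
    rintro f₁ f₂ ⟨hu₁, hh₁⟩ ⟨hu₂, hh₂⟩
    refine ⟨fun ε hε => ?_, fun g => ?_⟩
    · filter_upwards [hu₁ (ε / 2) (by positivity), hu₂ (ε / 2) (by positivity)] with h h₁ h₂ g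
      calc ‖(f₁ + f₂) (h * g) - (f₁ + f₂) g‖
          = ‖(f₁ (h * g) - f₁ g) + (f₂ (h * g) - f₂ g)‖ := by
            congr 1; simp only [BoundedContinuousFunction.coe_add, Pi.add_apply]; ring
        _ ≤ ‖f₁ (h * g) - f₁ g‖ + ‖f₂ (h * g) - f₂ g‖ := norm_add_le _ _
        _ < ε := by linarith [h₁ g, h₂ g]
    · simp only [BoundedContinuousFunction.coe_add, Pi.add_apply]
      rw [integral_add (hint f₁ g) (hint f₂ g), hh₁ g, hh₂ g]
  smul_mem' := by
    rintro c f ⟨hu, hh⟩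
    refine ⟨fun ε hε => ?_, fun g => ?_⟩
    · have hc : 0 < ‖c‖ + 1 := by positivity
      filter_upwards [hu (ε / (‖c‖ + 1)) (by positivity)] with h h₁ g
      have h₂ := h₁ g
      rw [lt_div_iff₀ hc] at h₂
      calc ‖(c • f) (h * g) - (c • f) g‖ = ‖c‖ * ‖f (h * g) - f g‖ := by
            rw [← norm_mul]; congr 1
            simp only [BoundedContinuousFunction.coe_smul, smul_eq_mul]; ring
        _ < ε := by nlinarith [norm_nonneg (f (h * g) - f g)]
    · simp only [BoundedContinuousFunction.coe_smul]
      rw [integral_smul, hh g]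

/-- The flow `(B, G)` with the measure `ν` is the topological universal Poisson `μ`-boundary: `ν`
is a regular Borel `μ`-stationary probability measure, and `F ↦ (g ↦ ∫ F (g x) dν(x))` is an
isometric linear isomorphism of `C(B)` onto the space of bounded left uniformly continuous
`μ`-harmonic functions on `G`. -/
structure IsTopologicalPoissonBoundary {G : Type u} [Group G] [TopologicalSpace G]
    [IsTopologicalGroup G] [SecondCountableTopology G] [MeasurableSpace G] [BorelSpace G]
    (μ : Measure G) [IsFiniteMeasure μ]
    (B : Type v) [TopologicalSpace B] [CompactSpace B] [T2Space B] [MulAction G B]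
    [ContinuousSMul G B] [MeasurableSpace B] [BorelSpace B] (ν : Measure B) : Prop where
  isProbabilityMeasure : IsProbabilityMeasure ν
  regular : ν.Regular
  stationary : IsStationary μ ν
  exists_isometry : ∃ Φ : C(B, ℂ) ≃ₗᵢ[ℂ] harmonicSpace μ,
    ∀ (F : C(B, ℂ)) (g : G), (Φ F : G →ᵇ ℂ) g = ∫ x, F (g • x) ∂ν

end PoissonFlow

/-! Harmonic functions give a map C(P) → C(B) with no map of spaces in sight. A stationary state η
on C(P) (`exists_stationary_functional`) turns F into the harmonic function g ↦ η(F(g ·)), and the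
harmonic functions are C(B). The result (`IsTopologicalPoissonBoundary.exists_contraction`) is an
equivariant unital contraction, hence positive (`realPart_nonneg`). Restricted to M, it assigns to
each b in M a probability measure on P, weak-* continuously and equivariantly. Strong proximality
makes some such measure a point mass. The points b with this property form a closed invariant set,
so all of M; the resulting map M → P is onto because P is minimal (`IsStronglyProximal.isFactor`).
-/

namespace PoissonFlow

/-! ### Translation of continuous functions on a flow -/

section Translation

variable {G X E : Type*} [Group G] [TopologicalSpace G] [TopologicalSpace X] [MulAction G X]
  [ContinuousSMul G X]

/-- The translate `x ↦ F (g • x)` of a continuous function on a flow. -/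
def smulComp [TopologicalSpace E] (g : G) (F : C(X, E)) : C(X, E) :=
  F.comp ⟨fun x => g • x, continuous_const_smul g⟩

@[simp]
lemma smulComp_apply [TopologicalSpace E] (g : G) (F : C(X, E)) (x : X) :
    smulComp g F x = F (g • x) := rfl

lemma smulComp_smulComp [TopologicalSpace E] (g h : G) (F : C(X, E)) :
    smulComp g (smulComp h F) = smulComp (h * g) F := by
  ext x; simp [mul_smul]

/-- Curry the jointly continuous action. For compact X this is sup-norm continuity, which underlies
both the Markov integral and left uniform continuity. -/
lemma continuous_smulComp [TopologicalSpace E] (F : C(X, E)) :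
    Continuous fun g : G => smulComp g F :=
  (ContinuousMap.curry ⟨fun p : G × X => F (p.1 • p.2), by fun_prop⟩).continuous

lemma norm_smulComp_le [CompactSpace X] [NormedAddCommGroup E] (g : G) (F : C(X, E)) :
    ‖smulComp g F‖ ≤ ‖F‖ :=
  (ContinuousMap.norm_le _ (norm_nonneg _)).2 fun x => F.norm_coe_le_norm (g • x)

lemma integrable_smulComp [CompactSpace X] [NormedAddCommGroup E] [SecondCountableTopology G]
    [MeasurableSpace G] [BorelSpace G] (μ : Measure G) [IsFiniteMeasure μ] (F : C(X, E)) :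
    Integrable (fun g : G => smulComp g F) μ :=
  Integrable.of_bound (continuous_smulComp F).aestronglyMeasurable ‖F‖
    (ae_of_all _ fun g => norm_smulComp_le g F)

end Translation

/-! ### Stationary states -/

section Stationary

variable {G : Type*} {X : Type*} [Group G] [TopologicalSpace G] [SecondCountableTopology G]
  [MeasurableSpace G] [BorelSpace G] [TopologicalSpace X] [CompactSpace X] [MulAction G X]
  [ContinuousSMul G X]

/-- The Markov operator `F ↦ ∫ F (g ·) dμ(g)` on continuous functions. -/
noncomputable def markovOperator (μ : Measure G) [IsProbabilityMeasure μ] :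
    C(X, ℂ) →L[ℂ] C(X, ℂ) :=
  LinearMap.mkContinuous
    { toFun := fun F => ∫ g, smulComp g F ∂μ
      map_add' := fun F₁ F₂ =>
        integral_add (integrable_smulComp μ F₁) (integrable_smulComp μ F₂)
      map_smul' := fun c F => integral_smul c fun g => smulComp g F } 1 fun F => by
    simpa using! norm_integral_le_of_norm_le_const (μ := μ)
      (ae_of_all _ fun g => norm_smulComp_le g F)

lemma markovOperator_apply (μ : Measure G) [IsProbabilityMeasure μ] (F : C(X, ℂ)) :
    markovOperator μ F = ∫ g, smulComp g F ∂μ := rfl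

lemma norm_markovOperator_apply_le (μ : Measure G) [IsProbabilityMeasure μ] (F : C(X, ℂ)) :
    ‖markovOperator μ F‖ ≤ ‖F‖ := by
  simpa [markovOperator_apply] using norm_integral_le_of_norm_le_const (μ := μ)
    (ae_of_all _ fun g => norm_smulComp_le g F)

lemma markovOperator_one (μ : Measure G) [IsProbabilityMeasure μ] :
    markovOperator μ (1 : C(X, ℂ)) = 1 := by
  have : ∀ g : G, smulComp g (1 : C(X, ℂ)) = 1 := fun g => rfl
  simp [markovOperator_apply, this]

lemma norm_iterate_markovOperator_le (μ : Measure G) [IsProbabilityMeasure μ] (F : C(X, ℂ))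
    (n : ℕ) : ‖(markovOperator μ)^[n] F‖ ≤ ‖F‖ := by
  induction n with
  | zero => simp
  | succ n ih =>
    rw [Function.iterate_succ_apply']
    exact (norm_markovOperator_apply_le μ _).trans ih

/-- Every flow carries a `μ`-stationary state. -/
lemma exists_stationary_functional [Nonempty X] (μ : Measure G) [IsProbabilityMeasure μ] :
    ∃ η : C(X, ℂ) →L[ℂ] ℂ, η 1 = 1 ∧ (∀ F, ‖η F‖ ≤ ‖F‖) ∧ ∀ F, η (markovOperator μ F) = η F := by
  obtain ⟨x₀⟩ := ‹Nonempty X›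
  set A := markovOperator (X := X) μ with hA
  -- Krylov–Bogoliubov: Cesàro averages of n + 1 Markov iterates of a point evaluation.
  let φ : ℕ → C(X, ℂ) →L[ℂ] ℂ := fun n =>
    ((n : ℂ) + 1)⁻¹ • ∑ k ∈ Finset.range (n + 1), (ContinuousMap.evalCLM ℂ x₀).comp (A ^ k)
  have hφ : ∀ n F, φ n F = ((n : ℂ) + 1)⁻¹ * ∑ k ∈ Finset.range (n + 1), (A^[k] F) x₀ := by
    intro n F
    simp [φ]
  have hn : ∀ n : ℕ, ‖((n : ℂ) + 1)⁻¹‖ = ((n : ℝ) + 1)⁻¹ := fun n => by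
    rw [norm_inv]; norm_cast
  have hb : ∀ F k, ‖(A^[k] F) x₀‖ ≤ ‖F‖ := fun F k =>
    ((A^[k] F).norm_coe_le_norm x₀).trans (norm_iterate_markovOperator_le μ F k)
  have hφle : ∀ n F, ‖φ n F‖ ≤ ‖F‖ := by
    intro n F
    rw [hφ, norm_mul, hn, inv_mul_le_iff₀ (by positivity)]
    refine (norm_sum_le_of_le _ fun k _ => hb F k).trans ?_
    simp
  have hφ1 : ∀ n, φ n 1 = 1 := by
    intro n
    have h1 : ∀ k, A^[k] (1 : C(X, ℂ)) = 1 := fun k =>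
      Function.iterate_fixed (markovOperator_one μ) k
    have : (n : ℂ) + 1 ≠ 0 := by exact_mod_cast n.succ_ne_zero
    simp [hφ, h1, this]
  have hφA : ∀ F, Tendsto (fun n => φ n (A F) - φ n F) atTop (𝓝 0) := by
    intro F
    -- The difference telescopes to two end terms, each at most ‖F‖.
    refine squeeze_zero_norm (a := fun n : ℕ => ((n : ℝ) + 1)⁻¹ * (2 * ‖F‖)) (fun n => ?_) ?_
    · have : φ n (A F) - φ n F = ((n : ℂ) + 1)⁻¹ * ((A^[n + 1] F) x₀ - F x₀) := by
        rw [hφ, hφ, ← mul_sub, ← Finset.sum_sub_distrib]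
        congr 1
        simp_rw [← Function.iterate_succ_apply]
        exact Finset.sum_range_sub (fun k => (A^[k] F) x₀) (n + 1)
      rw [this, norm_mul, hn]
      gcongr
      refine (norm_sub_le _ _).trans ?_
      linarith [hb F (n + 1), F.norm_coe_le_norm x₀]
    · have := tendsto_one_div_add_atTop_nhds_zero_nat (𝕜 := ℝ)
      simpa using this.mul_const (2 * ‖F‖)
  -- Banach–Alaoglu; a nonprincipal ultrafilter plays the role of a convergent subnet.
  have hcomp := WeakDual.isCompact_closedBall (𝕜 := ℂ) (0 : StrongDual ℂ C(X, ℂ)) 1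
  let U : Ultrafilter ℕ := hyperfilter ℕ
  let ψ : ℕ → WeakDual ℂ C(X, ℂ) := fun n => StrongDual.toWeakDual (φ n)
  obtain ⟨η, -, hη⟩ := hcomp.ultrafilter_le_nhds (U.map ψ) (by
    rw [le_principal_iff, Ultrafilter.coe_map, mem_map]
    refine Filter.univ_mem' fun n => ?_
    change dist (φ n) 0 ≤ 1
    rw [dist_zero_right]
    exact ContinuousLinearMap.opNorm_le_bound _ zero_le_one fun F => by simpa using hφle n F)
  have hlim : ∀ F, Tendsto (fun n : ℕ => φ n F) U (𝓝 (η F)) := fun F =>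
    ((WeakDual.eval_continuous F).tendsto η).comp hη
  have hU : (U : Filter ℕ) ≤ atTop := Nat.hyperfilter_le_atTop
  refine ⟨WeakDual.toStrongDual η, ?_, fun F => ?_, fun F => ?_⟩
  · exact tendsto_nhds_unique (hlim 1) (by simp [hφ1])
  · exact le_of_tendsto (hlim F).norm (Eventually.of_forall fun n => hφle n F)
  · exact sub_eq_zero.1 (tendsto_nhds_unique ((hlim (A F)).sub (hlim F)) ((hφA F).mono_left hU))

end Stationary

/-! ### From a stationary state to C(B) -/

section HarmonicTransform

variable {G : Type*} {X : Type*} [Group G] [TopologicalSpace G] [IsTopologicalGroup G]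
  [SecondCountableTopology G] [MeasurableSpace G] [BorelSpace G] [TopologicalSpace X]
  [CompactSpace X] [MulAction G X] [ContinuousSMul G X]

/-- A stationary state `η` maps continuous functions to bounded left uniformly continuous
harmonic functions by `F ↦ (g ↦ η (F (g ·)))`. -/
noncomputable def harmonicTransform (μ : Measure G) [IsProbabilityMeasure μ]
    (η : C(X, ℂ) →L[ℂ] ℂ) (hη : ∀ F, ‖η F‖ ≤ ‖F‖) (hμ : ∀ F, η (markovOperator μ F) = η F) :
    C(X, ℂ) →ₗ[ℂ] harmonicSpace μ where
  toFun F :=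
    ⟨BoundedContinuousFunction.ofNormedAddCommGroup (fun g : G => η (smulComp g F))
      (η.continuous.comp (continuous_smulComp F)) ‖F‖
      (fun g => (hη _).trans (norm_smulComp_le g F)), by
      refine ⟨fun ε hε => ?_, fun g => ?_⟩
      · have h1 : smulComp (1 : G) F = F := by ext x; simp
        have h := (continuous_smulComp F).tendsto (1 : G)
        rw [h1] at h
        filter_upwards [Metric.tendsto_nhds.1 h ε hε] with k hk g
        rw [dist_eq_norm] at hk
        refine lt_of_le_of_lt ?_ hk
        -- Factoring out the translation by g makes the bound uniform in g.
        have : smulComp (k * g) F - smulComp g F = smulComp g (smulComp k F - F) := by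
          ext x; simp [mul_smul]
        simp only [BoundedContinuousFunction.coe_ofNormedAddCommGroup, ← map_sub, this]
        exact (hη _).trans (norm_smulComp_le g _)
      -- Averaging over h applies the Markov operator to the g-translate of F, and η absorbs it.
      · simp only [BoundedContinuousFunction.coe_ofNormedAddCommGroup, ← smulComp_smulComp]
        rw [η.integral_comp_comm (integrable_smulComp μ (smulComp g F)), ← markovOperator_apply, hμ]⟩
  map_add' F₁ F₂ := by
    ext g
    exact map_add η (smulComp g F₁) (smulComp g F₂)
  map_smul' c F := by
    ext g
    exact map_smul η c (smulComp g F)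

lemma harmonicTransform_apply (μ : Measure G) [IsProbabilityMeasure μ]
    (η : C(X, ℂ) →L[ℂ] ℂ) (hη : ∀ F, ‖η F‖ ≤ ‖F‖) (hμ : ∀ F, η (markovOperator μ F) = η F)
    (F : C(X, ℂ)) (g : G) :
    (harmonicTransform μ η hη hμ F : G →ᵇ ℂ) g = η (smulComp g F) := rfl

lemma norm_harmonicTransform_le (μ : Measure G) [IsProbabilityMeasure μ]
    (η : C(X, ℂ) →L[ℂ] ℂ) (hη : ∀ F, ‖η F‖ ≤ ‖F‖) (hμ : ∀ F, η (markovOperator μ F) = η F)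
    (F : C(X, ℂ)) : ‖harmonicTransform μ η hη hμ F‖ ≤ ‖F‖ :=
  (BoundedContinuousFunction.norm_le (norm_nonneg _)).2 fun g =>
    (hη _).trans (norm_smulComp_le g F)

/-- Every flow `X` admits a unital equivariant contraction `C(X) → C(B)` into the continuous
functions on the topological universal Poisson boundary. -/
lemma IsTopologicalPoissonBoundary.exists_contraction [Nonempty X] {μ : Measure G}
    [IsProbabilityMeasure μ] {B : Type*} [TopologicalSpace B] [CompactSpace B] [T2Space B]
    [MulAction G B] [ContinuousSMul G B] [MeasurableSpace B] [BorelSpace B] {ν : Measure B}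
    (hB : IsTopologicalPoissonBoundary μ B ν) :
    ∃ S : C(X, ℂ) →ₗ[ℂ] C(B, ℂ), S 1 = 1 ∧ (∀ F, ‖S F‖ ≤ ‖F‖) ∧
      ∀ (g : G) (F : C(X, ℂ)), S (smulComp g F) = smulComp g (S F) := by
  obtain ⟨η, hη1, hη, hμ⟩ := exists_stationary_functional (X := X) μ
  obtain ⟨Φ, hΦ⟩ := hB.exists_isometry
  have := hB.isProbabilityMeasure
  refine ⟨Φ.symm.toLinearEquiv.toLinearMap ∘ₗ harmonicTransform μ η hη hμ, ?_, fun F => ?_,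
    fun g F => ?_⟩
  · change Φ.symm (harmonicTransform μ η hη hμ 1) = 1
    rw [LinearIsometryEquiv.symm_apply_eq]
    ext g
    rw [hΦ, harmonicTransform_apply]
    have : smulComp g (1 : C(X, ℂ)) = 1 := rfl
    simp [this, hη1]
  · change ‖Φ.symm (harmonicTransform μ η hη hμ F)‖ ≤ ‖F‖
    rw [LinearIsometryEquiv.norm_map]
    exact norm_harmonicTransform_le μ η hη hμ F
  · change Φ.symm (harmonicTransform μ η hη hμ _) =
      smulComp g (Φ.symm (harmonicTransform μ η hη hμ F))
    rw [LinearIsometryEquiv.symm_apply_eq]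
    ext k
    have h := hΦ (Φ.symm (harmonicTransform μ η hη hμ F)) (g * k)
    rw [LinearIsometryEquiv.apply_symm_apply, harmonicTransform_apply] at h
    rw [hΦ, harmonicTransform_apply, smulComp_smulComp, h]
    simp [mul_smul]

end HarmonicTransform

/-! ### Positivity of unital contractions -/

section RealPart

/-- The real part of a linear map `C(X, ℂ) → C(Y, ℂ)`, as a linear map `C(X, ℝ) → C(Y, ℝ)`. -/
noncomputable def realPart {X Y : Type*} [TopologicalSpace X] [TopologicalSpace Y]
    (S : C(X, ℂ) →ₗ[ℂ] C(Y, ℂ)) : C(X, ℝ) →ₗ[ℝ] C(Y, ℝ) where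
  toFun f := (⟨Complex.re, Complex.continuous_re⟩ : C(ℂ, ℝ)).comp
    (S ((⟨Complex.ofReal, Complex.continuous_ofReal⟩ : C(ℝ, ℂ)).comp f))
  map_add' f₁ f₂ := by
    rw [show (⟨Complex.ofReal, Complex.continuous_ofReal⟩ : C(ℝ, ℂ)).comp (f₁ + f₂) =
      (⟨Complex.ofReal, Complex.continuous_ofReal⟩ : C(ℝ, ℂ)).comp f₁ +
      (⟨Complex.ofReal, Complex.continuous_ofReal⟩ : C(ℝ, ℂ)).comp f₂ by ext; simp, map_add]
    ext; simp
  map_smul' c f := by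
    rw [show (⟨Complex.ofReal, Complex.continuous_ofReal⟩ : C(ℝ, ℂ)).comp (c • f) =
      (c : ℂ) • (⟨Complex.ofReal, Complex.continuous_ofReal⟩ : C(ℝ, ℂ)).comp f by
        ext; simp, map_smul]
    ext; simp

variable {X Y : Type*} [TopologicalSpace X] [TopologicalSpace Y]

lemma realPart_apply (S : C(X, ℂ) →ₗ[ℂ] C(Y, ℂ)) (f : C(X, ℝ)) (y : Y) : realPart S f y =
    (S ((⟨Complex.ofReal, Complex.continuous_ofReal⟩ : C(ℝ, ℂ)).comp f) y).re := rfl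

lemma realPart_one (S : C(X, ℂ) →ₗ[ℂ] C(Y, ℂ)) (h1 : S 1 = 1) : realPart S 1 = 1 := by
  ext y
  rw [realPart_apply, show (⟨Complex.ofReal, Complex.continuous_ofReal⟩ : C(ℝ, ℂ)).comp
    (1 : C(X, ℝ)) = 1 by ext; simp, h1]
  simp

/-- Since 0 ≤ f ≤ ‖f‖, the function ‖f‖ - f has norm at most ‖f‖. Hence |‖f‖ - S f| ≤ ‖f‖ pointwise,
which forces Re S f ≥ 0. -/
lemma realPart_nonneg [CompactSpace X] [CompactSpace Y] (S : C(X, ℂ) →ₗ[ℂ] C(Y, ℂ))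
    (h1 : S 1 = 1) (hS : ∀ F, ‖S F‖ ≤ ‖F‖) (f : C(X, ℝ)) (hf : 0 ≤ f) : 0 ≤ realPart S f := by
  intro y
  change 0 ≤ realPart S f y
  rw [realPart_apply]
  set F := (⟨Complex.ofReal, Complex.continuous_ofReal⟩ : C(ℝ, ℂ)).comp f with hF
  have hle : ‖(‖f‖ : ℂ) • (1 : C(X, ℂ)) - F‖ ≤ ‖f‖ := by
    refine (ContinuousMap.norm_le _ (norm_nonneg f)).2 fun x => ?_
    have h0 : 0 ≤ f x := hf x
    have h2 : f x ≤ ‖f‖ := (le_abs_self _).trans (f.norm_coe_le_norm x)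
    have : ((‖f‖ : ℂ) • (1 : C(X, ℂ)) - F) x = ((‖f‖ - f x : ℝ) : ℂ) := by simp [hF]
    rw [this, Complex.norm_real, Real.norm_of_nonneg (by linarith)]
    linarith
  have h := ((S _).norm_coe_le_norm y).trans ((hS _).trans hle)
  rw [map_sub, map_smul, h1] at h
  have h' := (Complex.re_le_norm _).trans h
  simp at h'
  simpa using h'

lemma realPart_smulComp {G : Type*} [Group G] [TopologicalSpace G] [MulAction G X]
    [ContinuousSMul G X] [MulAction G Y] [ContinuousSMul G Y] (S : C(X, ℂ) →ₗ[ℂ] C(Y, ℂ))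
    (hS : ∀ (g : G) (F : C(X, ℂ)), S (smulComp g F) = smulComp g (S F)) (g : G) (f : C(X, ℝ)) :
    realPart S (smulComp g f) = smulComp g (realPart S f) := by
  ext y
  rw [smulComp_apply, realPart_apply, realPart_apply, ← smulComp_apply (E := ℂ), ← hS]
  rfl

end RealPart

/-! ### From positive maps to factor maps -/

section Factor

/-- A positive unital functional on `C(X, ℝ)` is integration against a regular Borel probability
measure. -/
lemma exists_regular_probabilityMeasure_eq {X : Type*} [TopologicalSpace X] [CompactSpace X]
    [T2Space X] [MeasurableSpace X] [BorelSpace X] (Λ : C(X, ℝ) →ₗ[ℝ] ℝ) (h1 : Λ 1 = 1)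
    (hΛ : ∀ f, 0 ≤ f → 0 ≤ Λ f) :
    ∃ ρ : ProbabilityMeasure X, (ρ : Measure X).Regular ∧
      ∀ f : C(X, ℝ), ∫ x, f x ∂(ρ : Measure X) = Λ f := by
  -- Riesz–Markov; on compact X every continuous function has compact support.
  let L : CompactlySupportedContinuousMap X ℝ →ₚ[ℝ] ℝ := PositiveLinearMap.mk₀
    { toFun := fun f => Λ f.toContinuousMap
      map_add' := fun f g => map_add Λ f.toContinuousMap g.toContinuousMap
      map_smul' := fun c f => map_smul Λ c f.toContinuousMap } fun f hf => hΛ _ hf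
  have hint : ∀ f : C(X, ℝ), ∫ x, f x ∂(RealRMK.rieszMeasure L) = Λ f := fun f =>
    RealRMK.integral_rieszMeasure L (CompactlySupportedContinuousMap.continuousMapEquiv f)
  have hp : IsProbabilityMeasure (RealRMK.rieszMeasure L) := by
    have h := hint 1
    simp only [ContinuousMap.one_apply, integral_const, smul_eq_mul, mul_one, h1] at h
    exact ⟨by simpa [Measure.real, ENNReal.toReal_eq_one_iff] using h⟩
  exact ⟨⟨RealRMK.rieszMeasure L, hp⟩, RealRMK.regular_rieszMeasure L, hint⟩

lemma eq_of_forall_continuousMap_eq {X : Type*} [TopologicalSpace X] [CompactSpace X]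
    [T2Space X] {x y : X} (h : ∀ f : C(X, ℝ), f x = f y) : x = y := by
  by_contra hxy
  obtain ⟨f, h0, h1, -⟩ := exists_continuous_zero_one_of_isClosed (isClosed_singleton (x := x))
    (isClosed_singleton (x := y)) (by simpa using hxy)
  have := h f
  rw [h0 rfl, h1 rfl] at this
  simp at this

variable {G N P : Type*} [Group G] [TopologicalSpace G] [TopologicalSpace N] [CompactSpace N]
  [MulAction G N] [ContinuousSMul G N] [TopologicalSpace P] [CompactSpace P] [T2Space P]
  [MulAction G P] [ContinuousSMul G P]

/-- An equivariant positive unital map `C(P, ℝ) → C(N, ℝ)`, with `P` strongly proximal, sends some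
point evaluation of `N` to a point evaluation of `P`. -/
lemma IsStronglyProximal.exists_eval_eq [Nonempty N] [MeasurableSpace P] [BorelSpace P]
    (hP : IsStronglyProximal G P) (Λ : C(P, ℝ) →ₗ[ℝ] C(N, ℝ)) (h1 : Λ 1 = 1)
    (hpos : ∀ f, 0 ≤ f → 0 ≤ Λ f)
    (hΛ : ∀ (g : G) (f : C(P, ℝ)), Λ (smulComp g f) = smulComp g (Λ f)) :
    ∃ (b : N) (x : P), ∀ f, Λ f b = f x := by
  obtain ⟨b₀⟩ := ‹Nonempty N›
  obtain ⟨ρ, hρ, hint⟩ := exists_regular_probabilityMeasure_eq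
    ((ContinuousMap.evalCLM ℝ b₀).toLinearMap ∘ₗ Λ) (by simp [h1]) (fun f hf => hpos f hf b₀)
  obtain ⟨l, x, hl, hlim⟩ := hP ρ hρ
  have hlim' : ∀ f : C(P, ℝ), Tendsto (fun g => Λ f (g • b₀)) l (𝓝 (f x)) := by
    intro f
    have h := ProbabilityMeasure.tendsto_iff_forall_integral_tendsto.1 hlim
      (BoundedContinuousFunction.mkOfCompact f)
    have hx : ∫ y, f y ∂(diracProba x : Measure P) = f x := by simp [diracProba]
    -- By equivariance, translating ρ by g amounts to moving b₀ to g • b₀.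
    have hg : ∀ g : G, ∫ y, f y ∂(translate g ρ : Measure P) = Λ f (g • b₀) := by
      intro g
      rw [translate, ProbabilityMeasure.toMeasure_map, integral_map
        (continuous_const_smul g).measurable.aemeasurable f.continuous.aestronglyMeasurable]
      have := hint (smulComp g f)
      simpa [hΛ] using this
    simpa [hx, hg] using h
  have : NeBot l := hl
  -- Any cluster point b of the g • b₀ inherits the limiting point mass.
  obtain ⟨b, -, hb⟩ := isCompact_univ.ultrafilter_le_nhds ((Ultrafilter.of l).map (· • b₀))
    (by simp)
  exact ⟨b, x, fun f => tendsto_nhds_unique (((Λ f).continuous.tendsto b).comp hb)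
    ((hlim' f).mono_left (Ultrafilter.of_le l))⟩

/-- A minimal strongly proximal flow `P` is a factor of a minimal flow `N` if there is an
equivariant positive unital map `C(P, ℝ) → C(N, ℝ)`. -/
lemma IsStronglyProximal.isFactor [Nonempty N] [MulAction.IsMinimal G N] [MeasurableSpace P]
    [BorelSpace P] [MulAction.IsMinimal G P] (hP : IsStronglyProximal G P)
    (Λ : C(P, ℝ) →ₗ[ℝ] C(N, ℝ)) (h1 : Λ 1 = 1) (hpos : ∀ f, 0 ≤ f → 0 ≤ Λ f)
    (hΛ : ∀ (g : G) (f : C(P, ℝ)), Λ (smulComp g f) = smulComp g (Λ f)) :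
    IsFactor G N P := by
  -- The future graph of the factor map: b is paired with x when its measure is the point mass at x.
  let R : Set (N × P) := {p | ∀ f, Λ f p.1 = f p.2}
  have hR : IsClosed R := by
    simp only [R, Set.ofPred_forall]
    exact isClosed_iInter fun f => isClosed_eq (by fun_prop) (by fun_prop)
  have hR_smul : ∀ (g : G) (p : N × P), p ∈ R → (g • p.1, g • p.2) ∈ R := by
    intro g p hp f
    have := hp (smulComp g f)
    rwa [hΛ] at this
  have hex : ∀ b : N, ∃ x : P, (b, x) ∈ R := by
    obtain ⟨b₀, x₀, h₀⟩ := hP.exists_eval_eq Λ h1 hpos hΛ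
    have hcl : IsClosed (Prod.fst '' R) := isClosedMap_fst_of_compactSpace _ hR
    have hsub : MulAction.orbit G b₀ ⊆ Prod.fst '' R := by
      rintro _ ⟨g, rfl⟩
      exact ⟨_, hR_smul g (b₀, x₀) h₀, rfl⟩
    intro b
    obtain ⟨p, hp, rfl⟩ :=
      hcl.closure_subset_iff.2 hsub (MulAction.dense_orbit G b₀ b)
    exact ⟨p.2, hp⟩
  choose φ hφ using hex
  have hφ_eq : ∀ p ∈ R, φ p.1 = p.2 := fun p hp =>
    eq_of_forall_continuousMap_eq fun f => (hφ p.1 f).symm.trans (hp f)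
  have hφ_smul : ∀ (g : G) (b : N), φ (g • b) = g • φ b := fun g b =>
    hφ_eq _ (hR_smul g (b, φ b) (hφ b))
  have hφ_cont : Continuous φ := by
    refine continuous_iff_isClosed.2 fun K hK => ?_
    -- A map with closed graph into a compact space is continuous.
    have : φ ⁻¹' K = Prod.fst '' (R ∩ Prod.snd ⁻¹' K) := by
      ext b
      constructor
      · exact fun hb => ⟨(b, φ b), ⟨hφ b, hb⟩, rfl⟩
      · rintro ⟨p, ⟨hp, hpK⟩, rfl⟩
        rwa [Set.mem_preimage, hφ_eq p hp]
    rw [this]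
    exact isClosedMap_fst_of_compactSpace _ (hR.inter (hK.preimage continuous_snd))
  refine ⟨φ, hφ_cont, ?_, hφ_smul⟩
  obtain ⟨b₀⟩ := ‹Nonempty N›
  intro y
  have hsub : MulAction.orbit G (φ b₀) ⊆ Set.range φ := by
    rintro _ ⟨g, rfl⟩
    exact ⟨g • b₀, hφ_smul g b₀⟩
  exact (isCompact_range hφ_cont).isClosed.closure_subset_iff.2 hsub
    (MulAction.dense_orbit G (φ b₀) y)

end Factor

end PoissonFlow

theorem mainTheorem2 {G : Type u} [Group G] [TopologicalSpace G] [IsTopologicalGroup G]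
    [T2Space G] [LocallyCompactSpace G] [SecondCountableTopology G]
    [MeasurableSpace G] [BorelSpace G]
    (μ : Measure G) [IsProbabilityMeasure μ] (hμ : PoissonFlow.IsAdmissible μ)
    (B : Type v) [TopologicalSpace B] [CompactSpace B] [T2Space B] [MulAction G B]
    [ContinuousSMul G B] [MeasurableSpace B] [BorelSpace B] (ν : Measure B)
    (hB : PoissonFlow.IsTopologicalPoissonBoundary μ B ν)
    (P : Type u) [TopologicalSpace P] [CompactSpace P] [T2Space P] [MulAction G P]
    [ContinuousSMul G P] [MeasurableSpace P] [BorelSpace P]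
    (hP : PoissonFlow.IsUniversalMinimalStronglyProximal G P)
    (M : SubMulAction G B) (hM_closed : IsClosed (M : Set B)) (hM_nonempty : (M : Set B).Nonempty)
    (hM_minimal : MulAction.IsMinimal G M) :
    PoissonFlow.IsFactor G M P := by
  have := hP.nonempty
  have := hP.minimal
  have : Nonempty M := hM_nonempty.to_subtype
  have : CompactSpace M := isCompact_iff_compactSpace.1 hM_closed.isCompact
  obtain ⟨S, hS1, hS, hS_smul⟩ := hB.exists_contraction (X := P)
  -- M is invariant, so restricting functions to it preserves equivariance.
  refine hP.stronglyProximal.isFactor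
    { toFun := fun f => (PoissonFlow.realPart S f).restrict (M : Set B)
      map_add' := fun f₁ f₂ => by rw [map_add]; rfl
      map_smul' := fun c f => by rw [map_smul]; rfl } ?_ (fun f hf b => ?_) fun g f => ?_
  · change (PoissonFlow.realPart S 1).restrict (M : Set B) = 1
    rw [PoissonFlow.realPart_one S hS1]
    rfl
  · exact PoissonFlow.realPart_nonneg S hS1 hS f hf b
  · change (PoissonFlow.realPart S _).restrict (M : Set B) = _
    rw [PoissonFlow.realPart_smulComp S hS_smul]
    rfl
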